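/- Let $q$ be a prime power, $N$ and $\mathrm{tr}$ the norm and trace of $\mathbf F_{q^2}$ over $\mathbf F_q$, $\bar y=y^q$ for $y\in\mathbf F_{q^2}$, and $\psi:\mathbf F_q\to\mathbf C^*$ a non-trivial additive character. Let $L^2(\mathbf F_{q^2})$ be the space of all functions $\mathbf F_{q^2}\to\mathbf C$. For $\sigma=\begin{pmatrix}a&b\\c&d\end{pmatrix}\in SL_2(\mathbf F_q)$ and $f\in L^2(\mathbf F_{q^2})$ put $$(\tilde\rho(\sigma)f)(x)=\begin{cases}\psi(dcN(x))\,f(dx)&\text{if } b=0,\\ -\frac1q\sum_{y\in\mathbf F_{q^2}}\psi\!\left(\frac{dN(x)-\mathrm{tr}(\bar yx)+aN(y)}{b}\right)f(y)&\text{if } b\ne0.\end{cases}$$ Let $\omega:\mathbf F_{q^2}^*\to\mathbf C^*$ be a primitive character, that is, $\omega$ is not of the form $\chi\circ N$ with $\chi$ a character of $\mathbf F_q^*$, and let $$W_\omega=\{f\in L^2(\mathbf F_{q^2}) : f(yx)=\omega(y)^{-1}f(x)\text{ for all }x\in\mathbf F_{q^2}\text{ and all }y\in\mathbf F_{q^2}^*\text{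 with }N(y)=1\}.$$ Let $N_0\subset GL_2(\mathbf F_q)$ be the subgroup of upper triangular matrices with ones on the diagonal. For characters $\chi_1,\chi_2$ of $\mathbf F_q^*$ let $I(\chi_1,\chi_2)$ be the representation of $GL_2(\mathbf F_q)$ induced from the character $\begin{pmatrix}y_1&x\\0&y_2\end{pmatrix}\mapsto\chi_1(y_1)\chi_2(y_2)$ of the group of invertible upper triangular matrices. A complex representation $\pi$ of $GL_2(\mathbf F_q)$ is called cuspidal if $\mathrm{Hom}_{GL_2(\mathbf F_q)}(\pi,I(\chi_1,\chi_2))=0$ for all characters $\chi_1,\chi_2$ of $\mathbf F_q^*$. Then: 1. $\tilde\rho$ is a representation of $SL_2(\mathbf F_q)$ on $L^2(\mathbf F_{q^2})$ (the Weil representation), and $W_\omega$ is invariant under $\tilde\rho$ and has dimension $q-1$. 2. There is a unique representation $\pi_\omega$ of $GL_2(\mathbf F_q)$ on $W_\omega$ such that $$\left(\pi_\omega\!\left(\begin{pmatrix}1&0\\0&a\end{pmatrix}\sigma\right)f\right)(x)=\omega(\tilde a)\,(\tilde\rho(\sigma)f)(\tilde ax)$$ for all $a\in\mathbf F_q^*$,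 $\sigma\in SL_2(\mathbf F_q)$, $f\in W_\omega$, $x\in\mathbf F_{q^2}$ and all $\tilde a\in\mathbf F_{q^2}^*$ with $N(\tilde a)=a$; in particular the right-hand side does not depend on the choice of $\tilde a$. 3. $\pi_\omega$ has no non-zero vector fixed by $N_0$, and $\pi_\omega$ is cuspidal. 4. The degree of every finite-dimensional cuspidal representation of $GL_2(\mathbf F_q)$ is a multiple of $q-1$, and $\pi_\omega$ is irreducible. -/

import Mathlib

open Matrix

noncomputable section

namespace WeilGL2

/-! ### Parabolic induction and cuspidality for `GL₂(F)` -/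

section Cuspidal

variable (F : Type*) [Field F]

/-- The Borel subgroup `B` of invertible upper triangular matrices. -/
def borel : Subgroup (GL (Fin 2) F) where
  carrier := {g | g 1 0 = 0}
  mul_mem' {g h} hg hh := by
    simp only [Set.mem_ofPred_eq] at hg hh ⊢
    simp [Matrix.mul_apply, Fin.sum_univ_two, hg, hh]
  one_mem' := by simp
  inv_mem' {g} hg := by
    simp only [Set.mem_ofPred_eq] at hg ⊢
    simp [Matrix.inv_def, Matrix.adjugate_fin_two, hg]

/-- The unipotent subgroup `N` of upper triangular matrices with ones on the diagonal. -/
def unipotent : Subgroup (GL (Fin 2) F) where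
  carrier := {g | g 0 0 = 1 ∧ g 1 0 = 0 ∧ g 1 1 = 1}
  mul_mem' {g h} hg hh := by
    simp only [Set.mem_ofPred_eq] at hg hh ⊢
    simp [Matrix.mul_apply, Fin.sum_univ_two, hg, hh]
  one_mem' := by simp
  inv_mem' {g} hg := by
    simp only [Set.mem_ofPred_eq] at hg ⊢
    simp [Matrix.inv_def, Matrix.adjugate_fin_two, Matrix.det_fin_two, hg]

variable {F}

theorem borel_apply_one_zero (b : borel F) : (b : GL (Fin 2) F) 1 0 = 0 := b.2

theorem borel_diag_mul_ne_zero (b : borel F) :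
    (b : GL (Fin 2) F) 0 0 * (b : GL (Fin 2) F) 1 1 ≠ 0 := by
  have h : (b : GL (Fin 2) F).val.det ≠ 0 := (b : GL (Fin 2) F).det_ne_zero
  rw [Matrix.det_fin_two, borel_apply_one_zero b, mul_zero, sub_zero] at h
  exact h

/-- The character `(y₁ x; 0 y₂) ↦ χ₁(y₁) χ₂(y₂)` of `B`. -/
def borelCharacter (χ₁ χ₂ : Fˣ →* ℂˣ) : borel F →* ℂˣ where
  toFun b :=
    χ₁ (Units.mk0 ((b : GL (Fin 2) F) 0 0) (left_ne_zero_of_mul (borel_diag_mul_ne_zero b))) *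
    χ₂ (Units.mk0 ((b : GL (Fin 2) F) 1 1) (right_ne_zero_of_mul (borel_diag_mul_ne_zero b)))
  map_one' := by
    have h₁ : ∀ h, Units.mk0 (((1 : borel F) : GL (Fin 2) F) 0 0) h = 1 := fun h => by
      ext; simp
    have h₂ : ∀ h, Units.mk0 (((1 : borel F) : GL (Fin 2) F) 1 1) h = 1 := fun h => by
      ext; simp
    rw [h₁, h₂, map_one, map_one, one_mul]
  map_mul' b c := by
    rw [mul_mul_mul_comm, ← map_mul, ← map_mul]
    congr 2 <;> ext <;>
      simp [Matrix.mul_apply, Fin.sum_univ_two, borel_apply_one_zero]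

/-- The one-dimensional complex representation given by a character. -/
def characterRep {G : Type*} [Group G] (χ : G →* ℂˣ) : Representation ℂ G ℂ :=
  (Algebra.lmul ℂ ℂ : ℂ →* Module.End ℂ ℂ).comp ((Units.coeHom ℂ).comp χ)

/-- The space of functions `f : GL₂(F) → ℂ` with `f (b g) = χ(b) f(g)` for `b ∈ B`. -/
abbrev PrincipalSeriesSpace (χ₁ χ₂ : Fˣ →* ℂˣ) : Submodule ℂ (GL (Fin 2) F → ℂ) :=
  Representation.coindV (borel F).subtype (characterRep (borelCharacter χ₁ χ₂))

/-- The representation `I(χ₁, χ₂)` of `GL₂(F)` induced from the character of `B` attached to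
`χ₁, χ₂`; the group acts by right translation. -/
abbrev principalSeries (χ₁ χ₂ : Fˣ →* ℂˣ) :
    Representation ℂ (GL (Fin 2) F) (PrincipalSeriesSpace χ₁ χ₂) :=
  Representation.coind (borel F).subtype (characterRep (borelCharacter χ₁ χ₂))

/-- `π` is cuspidal if `Hom_{GL₂(F)}(π, I(χ₁, χ₂)) = 0` for all characters `χ₁, χ₂` of `Fˣ`. -/
def IsCuspidal {V : Type*} [AddCommGroup V] [Module ℂ V]
    (π : Representation ℂ (GL (Fin 2) F) V) : Prop :=
  ∀ χ₁ χ₂ : Fˣ →* ℂˣ, ∀ φ : Representation.IntertwiningMap π (principalSeries χ₁ χ₂), φ = 0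

/-- The matrix `(1 0; 0 a)`. -/
def diagOne (a : Fˣ) : GL (Fin 2) F where
  val := !![1, 0; 0, (a : F)]
  inv := !![1, 0; 0, ((a⁻¹ : Fˣ) : F)]
  val_inv := by simp [Matrix.one_fin_two]
  inv_val := by simp [Matrix.one_fin_two]

end Cuspidal

/-! ### The Weil representation on functions on a quadratic extension -/

section Weil

variable {F K : Type*} [Field F] [Fintype F] [Field K] [Fintype K] [Algebra F K]

/-- A character `ω` of `Kˣ` is primitive if it is not of the form `χ ∘ N`, where `χ` is a
character of `Fˣ` and `N : Kˣ → Fˣ` is the norm. -/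
def IsPrimitive (F : Type*) {K : Type*} [Field F] [Field K] [Algebra F K]
    (ω : Kˣ →* ℂˣ) : Prop :=
  ¬ ∃ χ : Fˣ →* ℂˣ, ω = χ.comp (Units.map (Algebra.norm F : K →* F))

open Classical in
/-- The operator `ρ̃(σ)` on the space of complex functions on `K`, for `σ = (a b; c d)` in
`SL₂(F)`: with `q = |F|` and `ȳ = y ^ q`, it sends `f` to
`x ↦ ψ(d c N(x)) f(d x)` if `b = 0`, and to
`x ↦ -q⁻¹ ∑ y, ψ((d N(x) - tr(ȳ x) + a N(y)) / b) f(y)` otherwise. -/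
def weilOperator (ψ : AddChar F ℂ) (σ : SpecialLinearGroup (Fin 2) F) :
    (K → ℂ) →ₗ[ℂ] (K → ℂ) where
  toFun f x :=
    if σ 0 1 = 0 then
      ψ (σ 1 1 * σ 1 0 * Algebra.norm F x) * f (algebraMap F K (σ 1 1) * x)
    else
      -(Fintype.card F : ℂ)⁻¹ * ∑ y : K,
        ψ ((σ 1 1 * Algebra.norm F x - Algebra.trace F K (y ^ Fintype.card F * x)
          + σ 0 0 * Algebra.norm F y) / σ 0 1) * f y
  map_add' f g := by
    ext x
    by_cases h : σ 0 1 = 0 <;> simp [h, mul_add, Finset.sum_add_distrib]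
  map_smul' r f := by
    ext x
    by_cases h : σ 0 1 = 0
    · simp [h, mul_left_comm]
    · simp only [h, if_false, Pi.smul_apply, smul_eq_mul, RingHom.id_apply, Finset.mul_sum]
      exact Finset.sum_congr rfl fun y _ => by ring

/-- The space `W_ω` of functions `f` on `K` with `f(y x) = ω(y)⁻¹ f(x)` for all `y` of norm `1`. -/
def weilSubspace (F : Type*) {K : Type*} [Field F] [Field K] [Algebra F K]
    (ω : Kˣ →* ℂˣ) : Submodule ℂ (K → ℂ) where
  carrier := {f | ∀ y : Kˣ, Algebra.norm F (y : K) = 1 →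
    ∀ x : K, f (y * x) = ((ω y)⁻¹ : ℂˣ) * f x}
  add_mem' hf hg y hy x := by simp [hf y hy x, hg y hy x, mul_add]
  zero_mem' y hy x := by simp
  smul_mem' r f hf y hy x := by simp [hf y hy x, mul_left_comm]

/-- `π` is the extension to `GL₂(F)` of the restriction of `ρ̃` to `W_ω`: for all `σ ∈ SL₂(F)`,
all `a ∈ Fˣ` and *every* `ã ∈ Kˣ` with `N(ã) = a`, the operator `π((1 0; 0 a) σ)` sends `f ∈ W_ω`
to the function `x ↦ ω(ã) (ρ̃(σ) f)(ã x)`. -/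
def IsWeilExtension (ψ : AddChar F ℂ) (ω : Kˣ →* ℂˣ)
    (π : Representation ℂ (GL (Fin 2) F) (weilSubspace F ω)) : Prop :=
  ∀ (σ : SpecialLinearGroup (Fin 2) F) (a : Fˣ) (t : Kˣ), Algebra.norm F (t : K) = a →
    ∀ (f : weilSubspace F ω) (x : K),
      (π (diagOne a * (σ : GL (Fin 2) F)) f : K → ℂ) x =
        (ω t : ℂ) * weilOperator ψ σ (f : K → ℂ) (t * x)

end Weil

end WeilGL2

end

/-! Composing two operators with `b, b' ≠ 0` leaves an inner sum over `y` of `ψ(e N(y) - tr(ȳ w) +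
r)`, where `e = b'' / (b b')` and `b''` is the upper right entry of the product. If `e = 0` this is
a delta function in `w`. If `e ≠ 0`, completing the square reduces it to the Gauss sum `-q` of
`sum_addChar_norm`, which is what the factor `-1/q` in the kernel compensates. Hence
`weilOperator_mul`.

Dilation by `t` of norm `a` carries `ρ̃(σ)` to `ρ̃` of the conjugate of `σ` by `(1 0; 0 a)`
(`weilOperator_comp_mul`). Norm-one `t` gives invariance of `W_ω`; general `t` gives the extension
to `GL₂`, the semidirect product of `SL₂` with the matrices `(1 0; 0 a)`. An element of `W_ω`
vanishes at `0` by primitivity and is free on the `q - 1` fibres of the norm, whence the dimension.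

Cuspidality amounts to the vanishing of the sum of `τ(n) v` over the unipotent group. Then only
non-trivial characters of that group occur in `V`. The `(1 0; 0 a)` permute these transitively, so
their eigenspaces have equal dimension and `q - 1` divides `dim V` (`card_sub_one_dvd_finrank`).
Since `dim W_ω = q - 1`, a subrepresentation is zero or everything. -/

noncomputable section

namespace WeilGL2


/-! ### Norm, trace and character sums on the quadratic extension -/

section NormTrace

variable {F K : Type*} [Field F] [Fintype F] [Field K] [Fintype K] [Algebra F K]

/-- The form `(x, y) ↦ tr(ȳ x)`, where `ȳ = y ^ |F|`. -/
def hermTrace (F : Type*) {K : Type*} [Field F] [Fintype F] [Field K] [Algebra F K]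
    (x y : K) : F :=
  Algebra.trace F K (y ^ Fintype.card F * x)

theorem algebraMap_norm_eq (hK : Module.finrank F K = 2) (x : K) :
    algebraMap F K (Algebra.norm F x) = x * x ^ Fintype.card F := by
  rw [FiniteField.algebraMap_norm_eq_prod_pow, hK, Nat.card_eq_fintype_card]
  simp [Finset.prod_range_succ]

theorem algebraMap_trace_eq (hK : Module.finrank F K = 2) (x : K) :
    algebraMap F K (Algebra.trace F K x) = x + x ^ Fintype.card F := by
  rw [FiniteField.algebraMap_trace_eq_sum_pow, hK, Nat.card_eq_fintype_card]
  simp [Finset.sum_range_succ]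

theorem pow_card_pow_card (hK : Module.finrank F K = 2) (x : K) :
    (x ^ Fintype.card F) ^ Fintype.card F = x := by
  have h := FiniteField.pow_card x
  rwa [Module.card_eq_pow_finrank (K := F) (V := K), hK, pow_two, pow_mul] at h

omit [Fintype K] in
theorem add_pow_card (x y : K) :
    (x + y) ^ Fintype.card F = x ^ Fintype.card F + y ^ Fintype.card F :=
  map_add (FiniteField.frobeniusAlgHom F K) x y

/-- Polarization without dividing by `2`, so characteristic `2` needs no separate treatment. -/
theorem norm_add (hK : Module.finrank F K = 2) (x y : K) :
    Algebra.norm F (x + y) = Algebra.norm F x + Algebra.norm F y + hermTrace F x y := by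
  apply (algebraMap F K).injective
  simp only [map_add, algebraMap_norm_eq hK, hermTrace, algebraMap_trace_eq hK, add_pow_card,
    mul_pow, pow_card_pow_card hK]
  ring

theorem hermTrace_comm (hK : Module.finrank F K = 2) (x y : K) :
    hermTrace F x y = hermTrace F y x := by
  have h := norm_add hK x y
  rw [add_comm x y, norm_add hK y x] at h
  linear_combination -h

omit [Fintype K] in
theorem hermTrace_add_left (x x' y : K) :
    hermTrace F (x + x') y = hermTrace F x y + hermTrace F x' y := by
  simp [hermTrace, mul_add]

omit [Fintype K] in
theorem hermTrace_add_right (x y y' : K) :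
    hermTrace F x (y + y') = hermTrace F x y + hermTrace F x y' := by
  simp [hermTrace, add_mul, add_pow_card]

omit [Fintype K] in
theorem hermTrace_smul_left (c : F) (x y : K) :
    hermTrace F (algebraMap F K c * x) y = c * hermTrace F x y := by
  rw [hermTrace, mul_left_comm, ← Algebra.smul_def, map_smul, smul_eq_mul, hermTrace]

theorem hermTrace_mul_mul (hK : Module.finrank F K = 2) (t x y : K) :
    hermTrace F (t * x) (t * y) = Algebra.norm F t * hermTrace F x y := by
  have h : (t * y) ^ Fintype.card F * (t * x)
      = Algebra.norm F t • (y ^ Fintype.card F * x) := by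
    rw [Algebra.smul_def, algebraMap_norm_eq hK]; ring
  rw [hermTrace, h, map_smul, smul_eq_mul, hermTrace]

omit [Fintype F] in
theorem norm_smul' (hK : Module.finrank F K = 2) (c : F) (x : K) :
    Algebra.norm F (algebraMap F K c * x) = c ^ 2 * Algebra.norm F x := by
  rw [map_mul, Algebra.norm_algebraMap, hK]

theorem exists_norm_eq (F : Type*) {K : Type*} [Field F] [Field K] [Finite K] [Algebra F K]
    (a : Fˣ) : ∃ t : Kˣ, Algebra.norm F (t : K) = a := by
  obtain ⟨t, ht⟩ := FiniteField.unitsMap_norm_surjective F K a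
  exact ⟨t, by rw [← ht]; rfl⟩

variable {ψ : AddChar F ℂ}

theorem sum_addChar_mul (hψ : ψ ≠ 1) (c : F) [Decidable (c = 0)] :
    ∑ x, ψ (x * c) = if c = 0 then (Fintype.card F : ℂ) else 0 := by
  classical
  have := AddChar.sum_mulShift c (AddChar.IsPrimitive.of_ne_one hψ)
  rw [this]
  split_ifs <;> simp

theorem sum_addChar_hermTrace (hK : Module.finrank F K = 2) (hψ : ψ ≠ 1) {w : K} (hw : w ≠ 0) :
    ∑ y, ψ (hermTrace F w y) = 0 := by
  let φ : K →+ F := ⟨⟨hermTrace F w, by simp [hermTrace]⟩, hermTrace_add_right w⟩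
  refine AddChar.sum_eq_zero_of_ne_one (ψ := ψ.compAddMonoidHom φ) fun h => ?_
  obtain ⟨c, hc⟩ := AddChar.ne_one_iff.1 hψ
  obtain ⟨z, rfl⟩ := Algebra.trace_surjective F K c
  apply hc
  -- This argument is chosen so that its pairing with `w` is `tr z`, where `ψ` is not `1`.
  have := DFunLike.congr_fun h (z / w ^ Fintype.card F)
  simp only [AddChar.compAddMonoidHom_apply, AddChar.one_apply] at this
  rw [← this]
  change _ = ψ (hermTrace F w _)
  rw [hermTrace_comm hK, hermTrace, mul_div_cancel₀ _ (pow_ne_zero _ hw)]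

/-- The sum `S e` takes one value on all `e ≠ 0`, because the norm is surjective on units. Since `S
0 = q²` and the total over `e` is `q`, that value satisfies `(q - 1) S = q - q²`. -/
theorem sum_addChar_norm (hK : Module.finrank F K = 2) (hψ : ψ ≠ 1) {e : F} (he : e ≠ 0) :
    ∑ y : K, ψ (e * Algebra.norm F y) = -(Fintype.card F : ℂ) := by
  classical
  set S : F → ℂ := fun e => ∑ y : K, ψ (e * Algebra.norm F y) with hS
  have hconst : ∀ a : Fˣ, S a = S 1 := fun a => by
    obtain ⟨t, ht⟩ := exists_norm_eq (K := K) F a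
    refine Fintype.sum_equiv (Units.mulLeft t) _ _ fun y => ?_
    simp [ht]
  have hzero : S 0 = (Fintype.card F : ℂ) ^ 2 := by
    simp [hS, Module.card_eq_pow_finrank (K := F) (V := K), hK]
  -- Summing over `a` first detects `N(y) = 0`, that is `y = 0`.
  have htot : ∑ a, S a = Fintype.card F := by
    simp only [hS]
    rw [Finset.sum_comm]
    simp [sum_addChar_mul hψ, Algebra.norm_eq_zero_iff]
  rw [← Finset.add_sum_erase _ _ (Finset.mem_univ 0), hzero,
    Finset.sum_congr rfl (g := fun _ => S 1)
      (fun a ha => hconst (Units.mk0 a (Finset.ne_of_mem_erase ha))), Finset.sum_const,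
    Finset.card_erase_of_mem (Finset.mem_univ _), Finset.card_univ, nsmul_eq_mul,
    Nat.cast_sub Fintype.card_pos, Nat.cast_one] at htot
  have hq : (Fintype.card F : ℂ) - 1 ≠ 0 := by
    rw [sub_ne_zero]
    exact_mod_cast Fintype.one_lt_card.ne'
  change S e = _
  rw [← Units.val_mk0 he, hconst]
  apply mul_left_cancel₀ hq
  linear_combination htot

theorem sum_addChar_norm_sub (hK : Module.finrank F K = 2) (hψ : ψ ≠ 1) {e : F} (he : e ≠ 0)
    (w : K) (r : F) :
    ∑ y : K, ψ (e * Algebra.norm F y - hermTrace F w y + r)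
      = -(Fintype.card F : ℂ) * ψ (r - Algebra.norm F w / e) := by
  rw [← sum_addChar_norm hK hψ he, Finset.sum_mul]
  -- Completing the square: `e N(y - w/e) = e N(y) - tr(ȳ w) + N(w)/e`.
  refine Fintype.sum_equiv (Equiv.addRight (algebraMap F K (-e⁻¹) * w)) _ _ fun y => ?_
  rw [← AddChar.map_add_eq_mul, Equiv.coe_addRight, norm_add hK, norm_smul' hK, hermTrace_comm hK w y,
    hermTrace_comm hK y (_ * w), hermTrace_smul_left, hermTrace_comm hK w y]
  congr 1
  field_simp
  ring

theorem sum_addChar_sub_hermTrace (hK : Module.finrank F K = 2) (hψ : ψ ≠ 1) (w : K) (r : F)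
    [Decidable (w = 0)] :
    ∑ y : K, ψ (r - hermTrace F w y)
      = if w = 0 then (Fintype.card F : ℂ) ^ 2 * ψ r else 0 := by
  split_ifs with hw
  · simp [hw, hermTrace, Module.card_eq_pow_finrank (K := F) (V := K), hK]
  · have hneg : -w ≠ 0 := neg_ne_zero.2 hw
    have := sum_addChar_hermTrace hK hψ hneg
    rw [← mul_zero (ψ r), ← this, Finset.mul_sum]
    refine Finset.sum_congr rfl fun y _ => ?_
    rw [← AddChar.map_add_eq_mul]
    simp [hermTrace, sub_eq_add_neg]

end NormTrace


/-! ### Multiplicativity of the Weil operators -/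

section WeilRepresentation

variable {F K : Type*} [Field F] [Fintype F] [Field K] [Fintype K] [Algebra F K]
  {ψ : AddChar F ℂ}

theorem weilOperator_apply_of_eq_zero (ψ : AddChar F ℂ) {σ : SpecialLinearGroup (Fin 2) F}
    (h : σ 0 1 = 0) (f : K → ℂ) (x : K) :
    weilOperator ψ σ f x
      = ψ (σ 1 1 * σ 1 0 * Algebra.norm F x) * f (algebraMap F K (σ 1 1) * x) :=
  if_pos h

theorem weilOperator_apply_of_ne_zero (ψ : AddChar F ℂ) {σ : SpecialLinearGroup (Fin 2) F}
    (h : σ 0 1 ≠ 0) (f : K → ℂ) (x : K) :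
    weilOperator ψ σ f x = -(Fintype.card F : ℂ)⁻¹ * ∑ y : K,
      ψ ((σ 1 1 * Algebra.norm F x - hermTrace F x y + σ 0 0 * Algebra.norm F y) / σ 0 1) * f y :=
  if_neg h

theorem weilOperator_one (ψ : AddChar F ℂ) :
    weilOperator ψ (1 : SpecialLinearGroup (Fin 2) F) = (LinearMap.id : (K → ℂ) →ₗ[ℂ] _) := by
  ext1 f
  ext x
  rw [weilOperator_apply_of_eq_zero ψ (by simp)]
  simp

theorem weilOperator_mul (hK : Module.finrank F K = 2) (hψ : ψ ≠ 1)
    (σ τ : SpecialLinearGroup (Fin 2) F) (f : K → ℂ) :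
    weilOperator ψ (σ * τ) f = weilOperator ψ σ (weilOperator ψ τ f) := by
  classical
  have hσ : σ 0 0 * σ 1 1 - σ 0 1 * σ 1 0 = 1 := by
    rw [← Matrix.det_fin_two]; exact σ.det_coe
  have hτ : τ 0 0 * τ 1 1 - τ 0 1 * τ 1 0 = 1 := by
    rw [← Matrix.det_fin_two]; exact τ.det_coe
  have h00 : (σ * τ) 0 0 = σ 0 0 * τ 0 0 + σ 0 1 * τ 1 0 := by
    simp [Matrix.mul_apply, Fin.sum_univ_two]
  have h01 : (σ * τ) 0 1 = σ 0 0 * τ 0 1 + σ 0 1 * τ 1 1 := by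
    simp [Matrix.mul_apply, Fin.sum_univ_two]
  have h10 : (σ * τ) 1 0 = σ 1 0 * τ 0 0 + σ 1 1 * τ 1 0 := by
    simp [Matrix.mul_apply, Fin.sum_univ_two]
  have h11 : (σ * τ) 1 1 = σ 1 0 * τ 0 1 + σ 1 1 * τ 1 1 := by
    simp [Matrix.mul_apply, Fin.sum_univ_two]
  have hq : (Fintype.card F : ℂ) ≠ 0 := by exact_mod_cast Fintype.card_ne_zero
  ext x
  by_cases hb : σ 0 1 = 0
  · have had : σ 0 0 * σ 1 1 = 1 := by linear_combination hσ + σ 1 0 * hb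
    rw [weilOperator_apply_of_eq_zero ψ hb]
    by_cases hb' : τ 0 1 = 0
    · rw [weilOperator_apply_of_eq_zero ψ hb',
        weilOperator_apply_of_eq_zero ψ (by rw [h01, hb, hb']; ring), ← mul_assoc,
        ← AddChar.map_add_eq_mul, h11, h10, hb', norm_smul' hK, ← mul_assoc (algebraMap F K _),
        ← map_mul]
      have ha'd' : τ 0 0 * τ 1 1 = 1 := by linear_combination hτ + τ 1 0 * hb'
      congr 2
      · linear_combination σ 1 0 * σ 1 1 * Algebra.norm F x * ha'd'
      · rw [mul_zero, zero_add, mul_comm (σ 1 1)]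
    · have ha : σ 0 0 ≠ 0 := left_ne_zero_of_mul_eq_one had
      rw [weilOperator_apply_of_ne_zero ψ hb',
        weilOperator_apply_of_ne_zero ψ (by rw [h01, hb]; simp [ha, hb']), mul_left_comm,
        Finset.mul_sum _ _ (ψ _)]
      congr 1
      refine Finset.sum_congr rfl fun y _ => ?_
      rw [← mul_assoc, ← AddChar.map_add_eq_mul, hermTrace_smul_left, norm_smul' hK, h11, h01, h00,
        hb]
      congr 2
      field_simp
      linear_combination -(τ 0 1 * (σ 1 0 * τ 0 1 * Algebra.norm F x
        + σ 1 1 * τ 1 1 * Algebra.norm F x - hermTrace F x y)) * had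
  · rw [weilOperator_apply_of_ne_zero ψ hb]
    by_cases hb' : τ 0 1 = 0
    · have ha'd' : τ 0 0 * τ 1 1 = 1 := by linear_combination hτ + τ 1 0 * hb'
      have hd' : τ 1 1 ≠ 0 := right_ne_zero_of_mul_eq_one ha'd'
      have hd'K : algebraMap F K (τ 1 1) ≠ 0 := by simpa using hd'
      rw [weilOperator_apply_of_ne_zero ψ (by rw [h01, hb']; simp [hb, hd'])]
      congr 1
      refine (Fintype.sum_equiv (Equiv.mulLeft₀ _ hd'K) _ _ fun y => ?_).symm
      rw [show Equiv.mulLeft₀ _ hd'K y = algebraMap F K (τ 1 1) * y from rfl]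
      rw [weilOperator_apply_of_eq_zero ψ hb', ← mul_assoc, ← AddChar.map_add_eq_mul,
        hermTrace_comm hK x (_ * y), hermTrace_smul_left, hermTrace_comm hK y x,
        norm_smul' hK, h11, h01, h00, hb']
      congr 2
      field_simp
      linear_combination -(σ 0 1 * τ 1 1 * σ 0 0 * Algebra.norm F y) * ha'd'
    · set q : ℂ := (Fintype.card F : ℂ) with hqdef
      set r : K → F := fun z => σ 1 1 * Algebra.norm F x / σ 0 1 + τ 0 0 * Algebra.norm F z / τ 0 1
        with hr
      set w : K → K := fun z => algebraMap F K (σ 0 1)⁻¹ * x + algebraMap F K (τ 0 1)⁻¹ * z with hw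
      -- `e`, `w z` and `r z` are the quadratic, linear and constant coefficients in `y` of the
      -- exponent of the composed kernel.
      set e : F := σ 0 0 / σ 0 1 + τ 1 1 / τ 0 1 with he
      have he' : e = (σ * τ) 0 1 / (σ 0 1 * τ 0 1) := by
        rw [he, h01]; field_simp
      have key : ∑ y : K,
          ψ ((σ 1 1 * Algebra.norm F x - hermTrace F x y + σ 0 0 * Algebra.norm F y) / σ 0 1)
            * weilOperator ψ τ f y
          = -q⁻¹ * ∑ z, (∑ y, ψ (e * Algebra.norm F y - hermTrace F (w z) y + r z)) * f z := by
        simp only [weilOperator_apply_of_ne_zero ψ hb', Finset.mul_sum, Finset.sum_mul]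
        rw [Finset.sum_comm]
        refine Finset.sum_congr rfl fun z _ => Finset.sum_congr rfl fun y _ => ?_
        rw [mul_left_comm, ← mul_assoc (ψ _), ← AddChar.map_add_eq_mul]
        congr 3
        simp only [hw, hr, he, hermTrace_add_left, hermTrace_smul_left, hermTrace_comm hK z y]
        field_simp
        ring
      rw [key, ← mul_assoc]
      by_cases hb'' : (σ * τ) 0 1 = 0
      · have he0 : e = 0 := by rw [he', hb'', zero_div]
        have hd'' : (σ * τ) 1 1 = -τ 0 1 / σ 0 1 := by
          rw [h01] at hb''
          rw [h11]
          field_simp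
          linear_combination σ 1 1 * hb'' - τ 0 1 * hσ
        have hwz : ∀ z, w z = 0 ↔ z = algebraMap F K ((σ * τ) 1 1) * x := fun z => by
          have h1 : algebraMap F K (σ 0 1) ≠ 0 := by simpa using hb
          have h2 : algebraMap F K (τ 0 1) ≠ 0 := by simpa using hb'
          rw [hd'', hw]
          simp only [map_inv₀, map_div₀, map_neg]
          constructor
          · intro h
            field_simp at h ⊢
            linear_combination h
          · rintro rfl
            field_simp
            ring
        simp only [he0, zero_mul, zero_sub, neg_add_eq_sub, sum_addChar_sub_hermTrace hK hψ, hwz,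
          ite_mul, Finset.sum_ite_eq', Finset.mem_univ, if_true]
        rw [weilOperator_apply_of_eq_zero ψ hb'']
        rw [← mul_assoc, ← mul_assoc, neg_mul_neg, ← hqdef]
        have : q⁻¹ * q⁻¹ * q ^ 2 = 1 := by field_simp
        rw [this, one_mul]
        congr 2
        simp only [hr, norm_smul' hK, hd'']
        rw [h10]
        rw [h01] at hb''
        field_simp
        linear_combination Algebra.norm F x * (σ 0 1 * σ 1 1 * hτ + τ 0 0 * τ 0 1 * hσ
          - τ 0 0 * σ 1 1 * hb'')
      · have he0 : e ≠ 0 := by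
          rw [he']; exact div_ne_zero hb'' (mul_ne_zero hb hb')
        simp only [sum_addChar_norm_sub hK hψ he0]
        rw [weilOperator_apply_of_ne_zero ψ hb'', Finset.mul_sum, Finset.mul_sum]
        refine Finset.sum_congr rfl fun z _ => ?_
        rw [← mul_assoc, ← mul_assoc, ← mul_assoc, neg_mul_neg, ← hqdef]
        have : q⁻¹ * q⁻¹ * -q = -q⁻¹ := by field_simp
        rw [this]
        congr 3
        simp only [hr, hw, norm_add hK, norm_smul' hK, hermTrace_smul_left, he',
          hermTrace_comm hK x (_ * z), hermTrace_comm hK z x]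
        field_simp
        rw [h11, h00, h01]
        linear_combination -(τ 0 1 ^ 2 * Algebra.norm F x) * hσ
          - σ 0 1 ^ 2 * Algebra.norm F z * hτ

end WeilRepresentation


/-! ### Unipotent eigenspaces and the degree of a cuspidal representation -/

section CuspidalDegree

open GeneralLinearGroup (upperRightHom upperRightHom_apply)

variable {F : Type*} [Field F] [Fintype F] {V : Type*} [AddCommGroup V] [Module ℂ V]

omit [Fintype F] in
theorem diagOne_mul_upperRightHom (a : Fˣ) (x : F) :
    diagOne a * upperRightHom (x * a) = upperRightHom x * diagOne a := by
  ext i j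
  fin_cases i <;> fin_cases j <;> simp [diagOne, Matrix.mul_apply, Fin.sum_univ_two]

/-- The projection onto the vectors on which `(1 x; 0 1)` acts by `ψ(a x)⁻¹`. -/
def unipotentProj (ψ : AddChar F ℂ) (τ : Representation ℂ (GL (Fin 2) F) V) (a : F) :
    Module.End ℂ V :=
  (Fintype.card F : ℂ)⁻¹ • ∑ x, ψ (x * a) • τ (upperRightHom x)

theorem unipotentProj_isIdempotentElem (ψ : AddChar F ℂ)
    (τ : Representation ℂ (GL (Fin 2) F) V) (a : F) :
    IsIdempotentElem (unipotentProj ψ τ a) := by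
  have hq : (Fintype.card F : ℂ) ≠ 0 := by exact_mod_cast Fintype.card_ne_zero
  have h : ∀ y, ψ (y * a) • τ (upperRightHom y) * ∑ x, ψ (x * a) • τ (upperRightHom x)
      = ∑ x, ψ (x * a) • τ (upperRightHom x) := fun y => by
    rw [Finset.mul_sum]
    refine Fintype.sum_equiv (Equiv.addLeft y) _ _ fun x => ?_
    rw [smul_mul_smul_comm, ← AddChar.map_add_eq_mul, ← map_mul, ← AddChar.map_add_eq_mul,
      ← add_mul, Equiv.coe_addLeft]
  rw [IsIdempotentElem, unipotentProj, smul_mul_smul_comm, Finset.sum_mul,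
    Finset.sum_congr rfl fun y _ => h y, Finset.sum_const, Finset.card_univ,
    ← Nat.cast_smul_eq_nsmul ℂ, smul_smul, mul_assoc, inv_mul_cancel₀ hq, mul_one]

theorem sum_unipotentProj {ψ : AddChar F ℂ} (hψ : ψ ≠ 1)
    (τ : Representation ℂ (GL (Fin 2) F) V) : ∑ a, unipotentProj ψ τ a = 1 := by
  classical
  have hq : (Fintype.card F : ℂ) ≠ 0 := by exact_mod_cast Fintype.card_ne_zero
  simp only [unipotentProj]
  rw [← Finset.smul_sum, Finset.sum_comm]
  have h : ∀ x, ∑ a, ψ (x * a) • τ (upperRightHom x)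
      = if x = 0 then (Fintype.card F : ℂ) • (1 : Module.End ℂ V) else 0 := fun x => by
    simp only [← Finset.sum_smul, mul_comm x, sum_addChar_mul hψ x]
    split_ifs with hx
    · rw [hx, AddChar.map_zero_eq_one, map_one]
    · rw [zero_smul]
  rw [Finset.sum_congr rfl fun x _ => h x, Finset.sum_ite_eq' Finset.univ (0 : F),
    if_pos (Finset.mem_univ _), smul_smul, inv_mul_cancel₀ hq, one_smul]

theorem diagOne_mul_unipotentProj (ψ : AddChar F ℂ) (τ : Representation ℂ (GL (Fin 2) F) V)
    (a : Fˣ) : τ (diagOne a) * unipotentProj ψ τ 1 = unipotentProj ψ τ a * τ (diagOne a) := by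
  rw [unipotentProj, unipotentProj, mul_smul_comm, smul_mul_assoc, Finset.mul_sum, Finset.sum_mul]
  congr 1
  refine (Fintype.sum_equiv (Units.mulRight a) _ _ fun x => ?_).symm
  rw [Units.mulRight_apply, mul_smul_comm, smul_mul_assoc, ← map_mul, ← map_mul,
    diagOne_mul_upperRightHom, mul_one]

theorem trace_unipotentProj (ψ : AddChar F ℂ) (τ : Representation ℂ (GL (Fin 2) F) V) (a : Fˣ) :
    LinearMap.trace ℂ V (unipotentProj ψ τ a) = LinearMap.trace ℂ V (unipotentProj ψ τ 1) := by
  have h : unipotentProj ψ τ a = τ (diagOne a) * unipotentProj ψ τ 1 * τ (diagOne a)⁻¹ := by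
    rw [diagOne_mul_unipotentProj, mul_assoc, ← map_mul, mul_inv_cancel, map_one, mul_one]
  rw [h, LinearMap.trace_mul_comm, ← mul_assoc, ← map_mul, inv_mul_cancel, map_one, one_mul]

/-- The projections `unipotentProj ψ τ a` sum to the identity, the one at `a = 0` vanishes by
hypothesis, and the other `q - 1` are conjugate. Taking traces, `dim V` is `q - 1` times the rank of
one of them. -/
theorem card_sub_one_dvd_finrank [FiniteDimensional ℂ V] {ψ : AddChar F ℂ} (hψ : ψ ≠ 1)
    (τ : Representation ℂ (GL (Fin 2) F) V)
    (h : ∀ v, ∑ x, τ (upperRightHom x) v = 0) :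
    (Fintype.card F - 1) ∣ Module.finrank ℂ V := by
  classical
  have h0 : unipotentProj ψ τ 0 = 0 := by
    ext v
    simp [unipotentProj, LinearMap.sum_apply, h v, -upperRightHom_apply]
  have htr := congrArg (LinearMap.trace ℂ V) (sum_unipotentProj hψ τ)
  rw [← Finset.add_sum_erase _ _ (Finset.mem_univ 0), h0, zero_add, map_sum,
    Finset.sum_congr rfl (g := fun _ => LinearMap.trace ℂ V (unipotentProj ψ τ 1))
      (fun a ha => trace_unipotentProj ψ τ (Units.mk0 a (Finset.ne_of_mem_erase ha))),
    Finset.sum_const, Finset.card_erase_of_mem (Finset.mem_univ _), Finset.card_univ,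
    (LinearMap.IsIdempotentElem.isProj_range _ (unipotentProj_isIdempotentElem ψ τ 1)).trace,
    LinearMap.trace_one,
    nsmul_eq_mul] at htr
  exact ⟨_, (by exact_mod_cast htr.symm)⟩

instance : Finite (borel F) := Subtype.finite

/-- The functional `v ↦ ∑ b ∈ B, χ(b)⁻¹ ℓ(b v)`. -/
def borelAverage (τ : Representation ℂ (GL (Fin 2) F) V) (ℓ : Module.Dual ℂ V)
    [Fintype (borel F)] (χ : borel F →* ℂˣ) : Module.Dual ℂ V :=
  ∑ b : borel F, ((χ b)⁻¹ : ℂˣ) • ℓ ∘ₗ τ b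

omit [Fintype F] in
theorem borelAverage_apply_mul (τ : Representation ℂ (GL (Fin 2) F) V) (ℓ : Module.Dual ℂ V)
    [Fintype (borel F)] (χ : borel F →* ℂˣ) (b : borel F) (v : V) :
    borelAverage τ ℓ χ (τ b v) = χ b * borelAverage τ ℓ χ v := by
  simp only [borelAverage, LinearMap.sum_apply, Finset.mul_sum]
  refine Fintype.sum_equiv (Equiv.mulRight b) _ _ fun c => ?_
  have hb : ((χ b : ℂˣ) : ℂ) ≠ 0 := Units.ne_zero _
  simp [Units.smul_def]
  field_simp

/-- The intertwining map `v ↦ (g ↦ ∑ b ∈ B, χ(b)⁻¹ ℓ(b g v))` into the principal series. -/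
def toPrincipalSeries (τ : Representation ℂ (GL (Fin 2) F) V) (ℓ : Module.Dual ℂ V)
    [Fintype (borel F)] (χ₁ χ₂ : Fˣ →* ℂˣ) :
    Representation.IntertwiningMap τ (principalSeries χ₁ χ₂) where
  toFun v := ⟨fun g => borelAverage τ ℓ (borelCharacter χ₁ χ₂) (τ g v), fun b g => by
    simpa [characterRep] using
      borelAverage_apply_mul τ ℓ (borelCharacter χ₁ χ₂) b (τ g v)⟩
  map_add' v w := by ext g; simp
  map_smul' c v := by ext g; simp
  isIntertwining' g := by
    ext v h
    change borelAverage τ ℓ _ (τ h (τ g v)) = borelAverage τ ℓ _ (τ (h * g) v)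
    rw [map_mul, Module.End.mul_apply]

theorem sum_monoidHom_apply_eq_zero {G : Type*} [CommGroup G] [Finite G] [Fintype (G →* ℂˣ)]
    {g : G} (hg : g ≠ 1) : ∑ χ : G →* ℂˣ, ((χ g : ℂˣ) : ℂ) = 0 := by
  obtain ⟨χ₀, h⟩ := CommGroup.exists_apply_ne_one_of_hasEnoughRootsOfUnity G ℂ hg
  have hsum : ∑ χ : G →* ℂˣ, ((χ g : ℂˣ) : ℂ) = χ₀ g * ∑ χ : G →* ℂˣ, ((χ g : ℂˣ) : ℂ) := by
    rw [Finset.mul_sum]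
    exact (Fintype.sum_equiv (Equiv.mulLeft χ₀) _ _ fun χ => by simp).symm
  have h' : ((χ₀ g : ℂˣ) : ℂ) - 1 ≠ 0 := by
    rw [sub_ne_zero]
    exact fun e => h (Units.ext e)
  apply mul_left_cancel₀ h'
  linear_combination -hsum

/-- By Frobenius reciprocity each functional `ℓ` averaged over `B` against a character gives a map
to a principal series, hence is zero. Adding these averages over all pairs `χ₁, χ₂` isolates the
unipotent elements of `B` by orthogonality of characters. -/
theorem IsCuspidal.sum_upperRightHom_eq_zero {τ : Representation ℂ (GL (Fin 2) F) V}
    (h : IsCuspidal τ) (v : V) : ∑ x, τ (upperRightHom x) v = 0 := by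
  classical
  have := Fintype.ofFinite (borel F)
  have := Fintype.ofFinite (Fˣ →* ℂˣ)
  rw [← Module.forall_dual_apply_eq_zero_iff ℂ]
  intro ℓ
  have hχ : ∀ χ₁ χ₂ : Fˣ →* ℂˣ, borelAverage τ ℓ (borelCharacter χ₁ χ₂) v = 0 := fun χ₁ χ₂ => by
    have h1 := congrArg (fun φ : Representation.IntertwiningMap τ (principalSeries χ₁ χ₂) =>
      (φ v : GL (Fin 2) F → ℂ) 1) (h χ₁ χ₂ (toPrincipalSeries τ ℓ χ₁ χ₂))
    simpa [toPrincipalSeries] using h1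
  let y₁ (b : borel F) : Fˣ := Units.mk0 ((b : GL (Fin 2) F) 0 0)
    (left_ne_zero_of_mul (borel_diag_mul_ne_zero b))
  let y₂ (b : borel F) : Fˣ := Units.mk0 ((b : GL (Fin 2) F) 1 1)
    (right_ne_zero_of_mul (borel_diag_mul_ne_zero b))
  let m : ℂ := Fintype.card (Fˣ →* ℂˣ)
  have hm : m ≠ 0 := Nat.cast_ne_zero.2 Fintype.card_ne_zero
  have hinv : ∀ y : Fˣ, ∑ χ : Fˣ →* ℂˣ, (((χ y)⁻¹ : ℂˣ) : ℂ) = if y = 1 then m else 0 := fun y => by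
    split_ifs with hy
    · simp [hy, m]
    · simp only [← map_inv]
      exact sum_monoidHom_apply_eq_zero (inv_ne_one.2 hy)
  have hsum : ∀ b : borel F, ∑ χ₁ : Fˣ →* ℂˣ, ∑ χ₂ : Fˣ →* ℂˣ,
      (((borelCharacter χ₁ χ₂ b)⁻¹ : ℂˣ) : ℂ)
        = (if y₁ b = 1 then m else 0) * (if y₂ b = 1 then m else 0) := fun b => by
    rw [← hinv, ← hinv, Finset.sum_mul_sum]
    refine Finset.sum_congr rfl fun χ₁ _ => Finset.sum_congr rfl fun χ₂ _ => ?_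
    rw [← Units.val_mul, ← mul_inv]
    rfl
  have htot : ∑ b : borel F, ((if y₁ b = 1 then m else 0) * (if y₂ b = 1 then m else 0))
      * ℓ (τ b v) = 0 := by
    simp_rw [← hsum, Finset.sum_mul]
    rw [Finset.sum_comm]
    refine Finset.sum_eq_zero fun χ₁ _ => ?_
    rw [Finset.sum_comm]
    refine Finset.sum_eq_zero fun χ₂ _ => ?_
    rw [← hχ χ₁ χ₂, borelAverage, LinearMap.sum_apply]
    rfl
  let i (x : F) : borel F := ⟨upperRightHom x, by simp [borel]⟩
  have hi : Function.Injective i := fun x x' hx =>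
    GeneralLinearGroup.injective_upperRightHom (congrArg Subtype.val hx)
  rw [← Fintype.sum_of_injective i hi (fun x => m * m * ℓ (τ (upperRightHom x) v)),
    ← Finset.mul_sum] at htot
  · rw [map_sum]
    exact (mul_eq_zero.1 htot).resolve_left (mul_ne_zero hm hm)
  · intro b hb
    by_cases h₁ : y₁ b = 1
    · by_cases h₂ : y₂ b = 1
      · refine absurd ⟨(b : GL (Fin 2) F) 0 1, ?_⟩ hb
        have h₁' := congrArg Units.val h₁
        have h₂' := congrArg Units.val h₂
        have h₃ := borel_apply_one_zero b
        simp only [y₁, y₂, Units.val_mk0, Units.val_one] at h₁' h₂'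
        ext j k
        fin_cases j <;> fin_cases k <;> simp [i, h₁', h₂', h₃]
      · simp [h₂]
    · simp [h₁]
  · intro x
    have h₁ : y₁ (i x) = 1 := by ext; simp [y₁, i]
    have h₂ : y₂ (i x) = 1 := by ext; simp [y₂, i]
    simp only [h₁, h₂, if_true, i]

end CuspidalDegree


/-! ### Extension of the Weil representation to `GL₂(F)` -/

section Extension

open GeneralLinearGroup (upperRightHom upperRightHom_apply)

variable {F K : Type*} [Field F] [Fintype F] [Field K] [Fintype K] [Algebra F K]

/-- The conjugate `(1 0; 0 a)⁻¹ σ (1 0; 0 a)`. -/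
def conjDiagOne (a : Fˣ) (σ : SpecialLinearGroup (Fin 2) F) : SpecialLinearGroup (Fin 2) F :=
  ⟨!![σ 0 0, σ 0 1 * a; σ 1 0 * (a⁻¹ : Fˣ), σ 1 1], by
    have h : σ 0 0 * σ 1 1 - σ 0 1 * σ 1 0 = 1 := by
      rw [← Matrix.det_fin_two]; exact σ.det_coe
    rw [Matrix.det_fin_two_of]
    linear_combination h - σ 0 1 * σ 1 0 * a.mul_inv⟩

omit [Fintype F] in
theorem coe_conjDiagOne (a : Fˣ) (σ : SpecialLinearGroup (Fin 2) F) :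
    (conjDiagOne a σ : Matrix (Fin 2) (Fin 2) F)
      = !![σ 0 0, σ 0 1 * a; σ 1 0 * (a⁻¹ : Fˣ), σ 1 1] :=
  rfl

/-- The component `σ ∈ SL₂(F)` of `g = (1 0; 0 det g) σ`. -/
def slPart (g : GL (Fin 2) F) : SpecialLinearGroup (Fin 2) F :=
  ⟨!![g 0 0, g 0 1; (g.det⁻¹ : Fˣ) * g 1 0, (g.det⁻¹ : Fˣ) * g 1 1], by
    have h : g 0 0 * g 1 1 - g 0 1 * g 1 0 = g.det := by
      rw [← Matrix.det_fin_two]; rfl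
    rw [Matrix.det_fin_two_of, mul_left_comm, mul_left_comm (g 0 1), ← mul_sub, h,
      Units.inv_mul]⟩

omit [Fintype F] in
theorem coe_slPart (g : GL (Fin 2) F) : (slPart g : Matrix (Fin 2) (Fin 2) F)
    = !![g 0 0, g 0 1; (g.det⁻¹ : Fˣ) * g 1 0, (g.det⁻¹ : Fˣ) * g 1 1] :=
  rfl

omit [Fintype F] in
theorem diagOne_mul_slPart (g : GL (Fin 2) F) :
    diagOne g.det * (slPart g : GL (Fin 2) F) = g := by
  ext i j
  fin_cases i <;> fin_cases j <;>
    simp [diagOne, coe_slPart, Matrix.mul_apply, Fin.sum_univ_two,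
      -GeneralLinearGroup.val_det_apply]

omit [Fintype F] in
theorem det_diagOne_mul (a : Fˣ) (σ : SpecialLinearGroup (Fin 2) F) :
    (diagOne a * (σ : GL (Fin 2) F)).det = a := by
  ext
  simp [diagOne]

omit [Fintype F] in
theorem slPart_diagOne_mul (a : Fˣ) (σ : SpecialLinearGroup (Fin 2) F) :
    slPart (diagOne a * (σ : GL (Fin 2) F)) = σ := by
  ext i j
  fin_cases i <;> fin_cases j <;>
    simp [coe_slPart, diagOne, Matrix.mul_apply, Fin.sum_univ_two]

omit [Fintype F] in
theorem slPart_one : slPart (1 : GL (Fin 2) F) = 1 := by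
  ext i j
  fin_cases i <;> fin_cases j <;> simp [coe_slPart]

omit [Fintype F] in
theorem slPart_mul (g h : GL (Fin 2) F) :
    slPart (g * h) = conjDiagOne h.det (slPart g) * slPart h := by
  ext i j
  have hh : (h.det : F) ≠ 0 := h.det.ne_zero
  have hg : (g.det : F) ≠ 0 := g.det.ne_zero
  fin_cases i <;> fin_cases j <;>
    simp [coe_slPart, coe_conjDiagOne, Matrix.mul_apply, Fin.sum_univ_two,
      -GeneralLinearGroup.val_det_apply] <;> field_simp

omit [Fintype F] in
theorem conjDiagOne_one (σ : SpecialLinearGroup (Fin 2) F) : conjDiagOne 1 σ = σ := by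
  ext i j
  fin_cases i <;> fin_cases j <;> simp [coe_conjDiagOne]

/-- Substituting `t y` for `y` scales both the norm and the hermitian pairing by `a`, and the
conjugation absorbs this factor by scaling `b` by `a` and `c` by `a⁻¹`. -/
theorem weilOperator_comp_mul (hK : Module.finrank F K = 2) (ψ : AddChar F ℂ) {a : Fˣ} {t : Kˣ}
    (ht : Algebra.norm F (t : K) = a) (σ : SpecialLinearGroup (Fin 2) F) (f : K → ℂ) (x : K) :
    weilOperator ψ σ (fun y => f (t * y)) x = weilOperator ψ (conjDiagOne a σ) f (t * x) := by
  have h00 : conjDiagOne a σ 0 0 = σ 0 0 := rfl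
  have h01 : conjDiagOne a σ 0 1 = σ 0 1 * a := rfl
  have h10 : conjDiagOne a σ 1 0 = σ 1 0 * (a⁻¹ : Fˣ) := rfl
  have h11 : conjDiagOne a σ 1 1 = σ 1 1 := rfl
  have ha : (a : F) ≠ 0 := a.ne_zero
  by_cases hb : σ 0 1 = 0
  · rw [weilOperator_apply_of_eq_zero ψ hb,
      weilOperator_apply_of_eq_zero ψ (by rw [h01, hb, zero_mul]), h10, h11,
      map_mul (Algebra.norm F), ht,
      mul_left_comm (t : K)]
    congr 2
    rw [Units.val_inv_eq_inv_val]
    field_simp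
  · rw [weilOperator_apply_of_ne_zero ψ hb,
      weilOperator_apply_of_ne_zero ψ (by rw [h01]; exact mul_ne_zero hb ha)]
    congr 1
    refine Fintype.sum_equiv (Units.mulLeft t) _ _ fun y => ?_
    rw [Units.mulLeft_apply, hermTrace_mul_mul hK, map_mul, map_mul, ht, h00, h01, h11]
    congr 2
    field_simp

theorem weilOperator_mem (hK : Module.finrank F K = 2) (ψ : AddChar F ℂ) {ω : Kˣ →* ℂˣ}
    (σ : SpecialLinearGroup (Fin 2) F) {f : K → ℂ} (hf : f ∈ weilSubspace F ω) :
    weilOperator ψ σ f ∈ weilSubspace F ω := by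
  intro t ht x
  rw [← conjDiagOne_one σ, ← weilOperator_comp_mul hK ψ (a := 1) ht, conjDiagOne_one]
  have h : (fun y => f (t * y)) = (((ω t)⁻¹ : ℂˣ) : ℂ) • f := funext (hf t ht)
  rw [h, map_smul]
  rfl

-- A character trivial on the kernel of the norm would factor through the norm, which is surjective.
omit [Fintype F] in
theorem IsPrimitive.exists_apply_ne_one {ω : Kˣ →* ℂˣ} (hω : IsPrimitive F ω) :
    ∃ u : Kˣ, Algebra.norm F (u : K) = 1 ∧ ω u ≠ 1 := by
  by_contra! h
  have hs := FiniteField.unitsMap_norm_surjective F K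
  have hker : (Units.map (Algebra.norm F : K →* F)).ker ≤ ω.ker := fun u hu =>
    h u (congrArg Units.val hu)
  exact hω ⟨_, (MonoidHom.liftOfRightInverse_comp _ (Function.surjInv hs)
    (Function.rightInverse_surjInv hs) ⟨ω, hker⟩).symm⟩

omit [Fintype F] in
theorem apply_zero_of_mem {ω : Kˣ →* ℂˣ} (hω : IsPrimitive F ω) {f : K → ℂ}
    (hf : f ∈ weilSubspace F ω) : f 0 = 0 := by
  obtain ⟨u, hu, hne⟩ := hω.exists_apply_ne_one
  have h := hf u hu 0
  rw [mul_zero] at h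
  by_contra h0
  apply hne
  have h1 : (((ω u)⁻¹ : ℂˣ) : ℂ) = 1 := mul_right_cancel₀ h0 (by rw [← h, one_mul])
  exact inv_eq_one.1 (Units.ext h1)

/-- A chosen element of `Kˣ` of norm `a`. -/
def normLift (K : Type*) [Field K] [Finite K] [Algebra F K] (a : Fˣ) : Kˣ :=
  (exists_norm_eq (K := K) F a).choose

omit [Fintype F] in
theorem norm_normLift (a : Fˣ) : Algebra.norm F (normLift K a : K) = a :=
  (exists_norm_eq (K := K) F a).choose_spec

-- Independence of the choice of `ã`: two choices differ by a norm-one element, on which the factors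
-- of `ω` cancel.
omit [Fintype F] [Fintype K] in
theorem mul_apply_mul_eq {ω : Kˣ →* ℂˣ} {f : K → ℂ} (hf : f ∈ weilSubspace F ω) {s t : Kˣ}
    (h : Algebra.norm F (s : K) = Algebra.norm F (t : K)) (x : K) :
    (ω s : ℂ) * f (s * x) = ω t * f (t * x) := by
  have hu : Algebra.norm F ((s / t : Kˣ) : K) = 1 := by
    have h' : Units.map (Algebra.norm F : K →* F) s = Units.map (Algebra.norm F : K →* F) t :=
      Units.ext h
    have h'' : Units.map (Algebra.norm F : K →* F) (s / t) = 1 := by rw [map_div, h', div_self']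
    exact congrArg Units.val h''
  have h1 := hf (s / t) hu (t * x)
  rw [← mul_assoc, ← Units.val_mul, div_mul_cancel] at h1
  rw [h1, ← mul_assoc, ← Units.val_mul, map_div]
  congr 2
  rw [inv_div, mul_div_cancel]

/-- `f` is encoded by `a ↦ ω(ã) f(ã)`, an arbitrary function on `Fˣ`; primitivity rules out any
further freedom at `0`. -/
theorem finrank_weilSubspace {ω : Kˣ →* ℂˣ} (hω : IsPrimitive F ω) :
    Module.finrank ℂ (weilSubspace F ω) = Fintype.card F - 1 := by
  classical
  let L : weilSubspace F ω →ₗ[ℂ] (Fˣ → ℂ) :=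
    { toFun := fun f a => ω (normLift K a) * (f : K → ℂ) (normLift K a)
      map_add' := fun f g => by ext a; simp [mul_add]
      map_smul' := fun c f => by ext a; simp [mul_left_comm] }
  have hL : ∀ (f : weilSubspace F ω) (u : Kˣ),
      L f (Units.map (Algebra.norm F : K →* F) u) = ω u * (f : K → ℂ) u := fun f u => by
    have := mul_apply_mul_eq f.2 (s := normLift K (Units.map (Algebra.norm F : K →* F) u)) (t := u)
      (norm_normLift _) 1
    rwa [mul_one, mul_one] at this
  have hinj : Function.Injective L := by
    refine (injective_iff_map_eq_zero L).2 fun f hf => ?_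
    ext x
    by_cases hx : x = 0
    · rw [hx, apply_zero_of_mem hω f.2]; rfl
    · have h := hL f (Units.mk0 x hx)
      rw [hf, Pi.zero_apply] at h
      exact (mul_eq_zero.1 h.symm).resolve_left (Units.ne_zero _)
  have hsurj : Function.Surjective L := fun φ => by
    let f : K → ℂ := fun x => if hx : x = 0 then 0 else
      ((ω (Units.mk0 x hx))⁻¹ : ℂˣ) * φ (Units.map (Algebra.norm F : K →* F) (Units.mk0 x hx))
    have hfu : ∀ u : Kˣ, f u = ((ω u)⁻¹ : ℂˣ) * φ (Units.map (Algebra.norm F : K →* F) u) :=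
      fun u => by simp [f]
    have hf : f ∈ weilSubspace F ω := fun y hy x => by
      by_cases hx : x = 0
      · simp [f, hx]
      · obtain ⟨u, rfl⟩ : ∃ u : Kˣ, (u : K) = x := ⟨Units.mk0 x hx, rfl⟩
        have hy' : Units.map (Algebra.norm F : K →* F) y = 1 := Units.ext hy
        rw [← Units.val_mul, hfu, hfu, map_mul, map_mul, hy', one_mul, mul_inv, Units.val_mul,
          mul_assoc]
    refine ⟨⟨f, hf⟩, funext fun a => ?_⟩
    obtain ⟨u, rfl⟩ := FiniteField.unitsMap_norm_surjective F K a
    rw [hL, Subtype.coe_mk, hfu, ← mul_assoc, Units.mul_inv, one_mul]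
  rw [(LinearEquiv.ofBijective L ⟨hinj, hsurj⟩).finrank_eq, Module.finrank_fintype_fun_eq_card,
    Fintype.card_units]

/-- The function `x ↦ ω(t) f(t x)`, as an operator on `W_ω`. -/
def scaleOperator (F : Type*) {K : Type*} [Field F] [Field K] [Algebra F K] (ω : Kˣ →* ℂˣ)
    (t : Kˣ) : Module.End ℂ (weilSubspace F ω) where
  toFun f := ⟨fun x => ω t * (f : K → ℂ) (t * x), fun y hy x => by
    change _ * (f : K → ℂ) (t * (y * x)) = _ * (_ * _)
    rw [mul_left_comm (t : K), f.2 y hy, mul_left_comm]⟩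
  map_add' f g := by ext x; simp [mul_add]
  map_smul' c f := by ext x; simp [mul_left_comm]

omit [Fintype F] [Fintype K] in
theorem scaleOperator_congr {ω : Kˣ →* ℂˣ} {s t : Kˣ}
    (h : Algebra.norm F (s : K) = Algebra.norm F (t : K)) :
    scaleOperator F ω s = scaleOperator F ω t := by
  ext f x
  exact mul_apply_mul_eq f.2 h x

omit [Fintype F] [Fintype K] in
theorem scaleOperator_mul (ω : Kˣ →* ℂˣ) (s t : Kˣ) :
    scaleOperator F ω (s * t) = scaleOperator F ω s * scaleOperator F ω t := by
  ext f x
  simp [scaleOperator, mul_assoc, mul_left_comm (s : K)]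

omit [Fintype F] [Fintype K] in
theorem scaleOperator_one (ω : Kˣ →* ℂˣ) : scaleOperator F ω 1 = 1 := by
  ext f x
  simp [scaleOperator]

/-- The restriction of `ρ̃(σ)` to `W_ω`. -/
def weilRestrict (hK : Module.finrank F K = 2) (ψ : AddChar F ℂ) (ω : Kˣ →* ℂˣ)
    (σ : SpecialLinearGroup (Fin 2) F) : Module.End ℂ (weilSubspace F ω) :=
  (weilOperator ψ σ).restrict fun _ hf => weilOperator_mem hK ψ σ hf

theorem weilRestrict_mul_scaleOperator (hK : Module.finrank F K = 2) (ψ : AddChar F ℂ)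
    (ω : Kˣ →* ℂˣ) {a : Fˣ} {t : Kˣ} (ht : Algebra.norm F (t : K) = a)
    (σ : SpecialLinearGroup (Fin 2) F) :
    weilRestrict hK ψ ω σ * scaleOperator F ω t
      = scaleOperator F ω t * weilRestrict hK ψ ω (conjDiagOne a σ) := by
  ext f x
  change weilOperator ψ σ ((ω t : ℂ) • fun y => (f : K → ℂ) (t * y)) x = _
  rw [map_smul, Pi.smul_apply, weilOperator_comp_mul hK ψ ht]
  rfl

/-- The representation `π_ω` of `GL₂(F)` on `W_ω`. -/
def weilExtension (hK : Module.finrank F K = 2) {ψ : AddChar F ℂ} (hψ : ψ ≠ 1) (ω : Kˣ →* ℂˣ) :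
    Representation ℂ (GL (Fin 2) F) (weilSubspace F ω) where
  toFun g := scaleOperator F ω (normLift K g.det) * weilRestrict hK ψ ω (slPart g)
  map_one' := by
    rw [scaleOperator_congr (t := 1) (by rw [norm_normLift]; simp), scaleOperator_one, slPart_one,
      one_mul]
    ext f x
    change weilOperator ψ 1 (f : K → ℂ) x = _
    rw [weilOperator_one]
    rfl
  map_mul' g h := by
    have hmul : weilRestrict hK ψ ω (conjDiagOne h.det (slPart g) * slPart h)
        = weilRestrict hK ψ ω (conjDiagOne h.det (slPart g)) * weilRestrict hK ψ ω (slPart h) := by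
      ext f x
      exact congrFun (weilOperator_mul hK hψ _ _ _) x
    -- The chosen lifts need not be multiplicative, but the dilation operators depend only on norms.
    rw [scaleOperator_congr (t := normLift K g.det * normLift K h.det)
      (by simp only [Units.val_mul, map_mul, norm_normLift]), scaleOperator_mul, slPart_mul, hmul,
      mul_assoc, mul_assoc, ← mul_assoc (scaleOperator F ω (normLift K h.det)),
      ← weilRestrict_mul_scaleOperator hK ψ ω (norm_normLift _), mul_assoc]

theorem isWeilExtension_weilExtension (hK : Module.finrank F K = 2) {ψ : AddChar F ℂ} (hψ : ψ ≠ 1)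
    (ω : Kˣ →* ℂˣ) : IsWeilExtension ψ ω (weilExtension hK hψ ω) := by
  intro σ a t ht f x
  change (scaleOperator F ω (normLift K _) (weilRestrict hK ψ ω (slPart _) f) : K → ℂ) x = _
  rw [det_diagOne_mul, slPart_diagOne_mul,
    scaleOperator_congr (t := t) (by rw [norm_normLift, ht])]
  rfl

theorem IsWeilExtension.unique {ψ : AddChar F ℂ} {ω : Kˣ →* ℂˣ}
    {π π' : Representation ℂ (GL (Fin 2) F) (weilSubspace F ω)} (h : IsWeilExtension ψ ω π)
    (h' : IsWeilExtension ψ ω π') : π' = π := by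
  ext g f x
  rw [← diagOne_mul_slPart g, h' _ _ _ (norm_normLift _), h _ _ _ (norm_normLift _)]

/-! ### Fixed vectors, cuspidality and irreducibility -/

/-- The Weyl element `w` moves a fixed vector to one fixed by the lower unipotents `(1 0; c 1)`.
These act by multiplication by `ψ(c N(x))`, which forces vanishing at every `x ≠ 0`; at `0`
primitivity applies. -/
theorem IsWeilExtension.eq_zero_of_forall_unipotent {ψ : AddChar F ℂ} (hψ : ψ ≠ 1)
    {ω : Kˣ →* ℂˣ} (hω : IsPrimitive F ω)
    {π : Representation ℂ (GL (Fin 2) F) (weilSubspace F ω)} (h : IsWeilExtension ψ ω π)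
    {f : weilSubspace F ω} (hf : ∀ n ∈ unipotent F, π n f = f) : f = 0 := by
  obtain ⟨w, hw⟩ : ∃ w : SpecialLinearGroup (Fin 2) F,
      (w : Matrix (Fin 2) (Fin 2) F) = !![0, 1; -1, 0] :=
    ⟨⟨!![0, 1; -1, 0], by simp [Matrix.det_fin_two]⟩, rfl⟩
  have hl' : ∀ c : F, ∃ l : SpecialLinearGroup (Fin 2) F,
      (l : Matrix (Fin 2) (Fin 2) F) = !![1, 0; c, 1] := fun c =>
    ⟨⟨!![1, 0; c, 1], by simp [Matrix.det_fin_two]⟩, rfl⟩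
  choose l hl using hl'
  have hlw : ∀ c, (diagOne 1 * (l c : GL (Fin 2) F)) * (w : GL (Fin 2) F)
      = (w : GL (Fin 2) F) * upperRightHom (-c) := fun c => by
    ext i j
    fin_cases i <;> fin_cases j <;>
      simp [diagOne, hl, hw, Matrix.mul_apply, Fin.sum_univ_two]
  have hfix : ∀ c, π (diagOne 1 * (l c : GL (Fin 2) F)) (π (w : GL (Fin 2) F) f)
      = π (w : GL (Fin 2) F) f := fun c => by
    rw [← Module.End.mul_apply, ← map_mul, hlw, map_mul, Module.End.mul_apply,
      hf _ (by simp [unipotent])]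
  have hzero : π (w : GL (Fin 2) F) f = 0 := by
    ext x
    by_cases hx : x = 0
    · rw [hx, apply_zero_of_mem hω (Subtype.prop _)]; rfl
    obtain ⟨c, hc⟩ := AddChar.ne_one_iff.1 hψ
    have hN : Algebra.norm F x ≠ 0 := Algebra.norm_ne_zero_iff.2 hx
    -- This entry makes the multiplier at `x` equal to `ψ c`, which is not `1`.
    have h1 := h (l (c / Algebra.norm F x)) 1 1 (by simp) (π (w : GL (Fin 2) F) f) x
    rw [hfix, weilOperator_apply_of_eq_zero ψ (by simp [hl])] at h1
    have h2 : (π (w : GL (Fin 2) F) f : K → ℂ) x = ψ c * (π (w : GL (Fin 2) F) f : K → ℂ) x := by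
      simpa [hl, hN] using h1
    have h3 : ψ c - 1 ≠ 0 := sub_ne_zero.2 hc
    refine (mul_eq_zero.1 (?_ : (ψ c - 1) * _ = 0)).resolve_left h3
    linear_combination -h2
  have := congrArg (π (w : GL (Fin 2) F)⁻¹) hzero
  rwa [← Module.End.mul_apply, ← map_mul, inv_mul_cancel, map_one, map_zero] at this

theorem sum_upperRightHom_eq_zero_of_forall_unipotent {V : Type*} [AddCommGroup V] [Module ℂ V]
    {τ : Representation ℂ (GL (Fin 2) F) V}
    (h : ∀ v, (∀ n ∈ unipotent F, τ n v = v) → v = 0) (v : V) :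
    ∑ x, τ (upperRightHom x) v = 0 := by
  refine h _ fun n hn => ?_
  have hn' : n = upperRightHom (n 0 1) := by
    obtain ⟨h0, h1, h2⟩ := hn
    ext i j
    fin_cases i <;> fin_cases j <;> simp [h0, h1, h2]
  rw [hn', map_sum]
  refine Fintype.sum_equiv (Equiv.addLeft (n 0 1)) _ _ fun x => ?_
  rw [← Module.End.mul_apply, ← map_mul, ← AddChar.map_add_eq_mul]
  rfl

/-- The inducing character is trivial on unipotents, so `v ↦ (φ v)(1)` is invariant under them: `q`
times it is its value on a sum that vanishes. Translating by `g` then kills `φ v` everywhere. -/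
theorem isCuspidal_of_sum_upperRightHom_eq_zero {V : Type*} [AddCommGroup V] [Module ℂ V]
    {τ : Representation ℂ (GL (Fin 2) F) V} (h : ∀ v, ∑ x, τ (upperRightHom x) v = 0) :
    IsCuspidal τ := by
  intro χ₁ χ₂ φ
  have htr : ∀ g v, (φ (τ g v) : GL (Fin 2) F → ℂ) 1 = (φ v : GL (Fin 2) F → ℂ) g := fun g v => by
    rw [φ.isIntertwining]
    change (φ v : GL (Fin 2) F → ℂ) (1 * g) = _
    rw [one_mul]
  have hu : ∀ x v, (φ v : GL (Fin 2) F → ℂ) (upperRightHom x) = (φ v : GL (Fin 2) F → ℂ) 1 :=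
    fun x v => by
    have h1 := (φ v).2 ⟨upperRightHom x, by simp [borel]⟩ 1
    rw [mul_one] at h1
    refine h1.trans ?_
    have hχ : borelCharacter χ₁ χ₂ ⟨upperRightHom x, by simp [borel]⟩ = 1 := by
      simp [borelCharacter]
    rw [characterRep, MonoidHom.comp_apply, MonoidHom.comp_apply, hχ]
    simp
  have h1 : ∀ v, (φ v : GL (Fin 2) F → ℂ) 1 = 0 := fun v => by
    have h2 := congrArg (fun u => (φ u : GL (Fin 2) F → ℂ) 1) (h v)
    simpa [map_sum, Finset.sum_apply, htr, hu, -upperRightHom_apply] using h2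
  ext v g
  exact (htr g v).symm.trans (h1 _)

theorem isIrreducible_of_finrank {V : Type*} [AddCommGroup V] [Module ℂ V] [FiniteDimensional ℂ V]
    {τ : Representation ℂ (GL (Fin 2) F) V} {ψ : AddChar F ℂ} (hψ : ψ ≠ 1)
    (h : ∀ v, ∑ x, τ (upperRightHom x) v = 0)
    (hV : Module.finrank ℂ V = Fintype.card F - 1) : τ.IsIrreducible := by
  have hpos : 0 < Module.finrank ℂ V := by
    rw [hV]; exact Nat.sub_pos_of_lt Fintype.one_lt_card
  have : Nontrivial V := Module.nontrivial_of_finrank_pos hpos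
  have hnt : Nontrivial (Subrepresentation τ) :=
    ⟨⊥, ⊤, fun e => bot_ne_top (congrArg Subrepresentation.toSubmodule e)⟩
  refine { eq_bot_or_eq_top := fun U => ?_ }
  have hdvd := card_sub_one_dvd_finrank hψ U.toRepresentation fun v => by
    ext
    simpa [Subrepresentation.toRepresentation, -upperRightHom_apply] using h v
  rw [← hV] at hdvd
  -- The dimension of `U` is a multiple of `dim V` and at most `dim V`.
  rcases Nat.eq_zero_or_pos (Module.finrank ℂ U.toSubmodule) with h0 | h0
  · left
    exact Subrepresentation.toSubmodule_injective (Submodule.finrank_eq_zero.1 h0)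
  · right
    exact Subrepresentation.toSubmodule_injective (Submodule.eq_top_of_finrank_eq
      (le_antisymm (Submodule.finrank_le _) (Nat.le_of_dvd h0 hdvd)))

end Extension

end WeilGL2

end

theorem mainTheorem3 {F : Type*} {K : Type*} [Field F] [Fintype F] [Field K] [Fintype K]
    [Algebra F K] (hK : Module.finrank F K = 2) (ψ : AddChar F ℂ) (hψ : ψ ≠ 1)
    (ω : Kˣ →* ℂˣ) (hω : WeilGL2.IsPrimitive F ω) :
    -- `ρ̃` is a representation of `SL₂(F)` on the functions on `K`
    (∃ ρ : Representation ℂ (Matrix.SpecialLinearGroup (Fin 2) F) (K → ℂ),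
      ∀ σ, ρ σ = WeilGL2.weilOperator ψ σ) ∧
    -- `W_ω` is an invariant subspace, of dimension `q - 1`
    (∀ σ, ∀ f ∈ WeilGL2.weilSubspace F ω,
      WeilGL2.weilOperator ψ σ f ∈ WeilGL2.weilSubspace F ω) ∧
    Module.finrank ℂ (WeilGL2.weilSubspace F ω) = Fintype.card F - 1 ∧
    -- there is a unique extension `π_ω` to `GL₂(F)`; it has no nonzero `N`-fixed vector,
    -- it is cuspidal and irreducible
    (∃ π : Representation ℂ (Matrix.GeneralLinearGroup (Fin 2) F) (WeilGL2.weilSubspace F ω),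
      WeilGL2.IsWeilExtension ψ ω π ∧
      (∀ π', WeilGL2.IsWeilExtension ψ ω π' → π' = π) ∧
      (∀ f, (∀ n ∈ WeilGL2.unipotent F, π n f = f) → f = 0) ∧
      WeilGL2.IsCuspidal π ∧
      π.IsIrreducible) ∧
    -- the degree of any cuspidal representation of `GL₂(F)` is a multiple of `q - 1`
    (∀ (V : Type*) [AddCommGroup V] [Module ℂ V] [FiniteDimensional ℂ V]
      (τ : Representation ℂ (Matrix.GeneralLinearGroup (Fin 2) F) V),
      WeilGL2.IsCuspidal τ → (Fintype.card F - 1) ∣ Module.finrank ℂ V) := by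
  have hπ := WeilGL2.isWeilExtension_weilExtension hK hψ ω
  have hfix : ∀ f, (∀ n ∈ WeilGL2.unipotent F, WeilGL2.weilExtension hK hψ ω n f = f) → f = 0 :=
    fun f hf => hπ.eq_zero_of_forall_unipotent hψ hω hf
  have hsum := WeilGL2.sum_upperRightHom_eq_zero_of_forall_unipotent hfix
  have hdim := WeilGL2.finrank_weilSubspace hω
  refine ⟨⟨{ toFun := WeilGL2.weilOperator ψ
             map_one' := WeilGL2.weilOperator_one ψ
             map_mul' := fun σ τ => LinearMap.ext (WeilGL2.weilOperator_mul hK hψ σ τ) },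
      fun σ => rfl⟩, fun σ f hf => WeilGL2.weilOperator_mem hK ψ σ hf, hdim,
    ⟨WeilGL2.weilExtension hK hψ ω, hπ, fun π' hπ' => hπ.unique hπ', hfix,
      WeilGL2.isCuspidal_of_sum_upperRightHom_eq_zero hsum,
      WeilGL2.isIrreducible_of_finrank hψ hsum hdim⟩,
    fun V _ _ _ τ hτ => WeilGL2.card_sub_one_dvd_finrank hψ τ hτ.sum_upperRightHom_eq_zero⟩
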